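/- **Setting.** For a topological space $L$ let $c(L)=(L\times[0,\infty))/(L\times\{0\})$ be its cone, with vertex $*$ and radial function $\rho([x,r])=r$. Let $L,L'$ be compact Hausdorff spaces, and let $N\subset L$, $N'\subset L'$ be nonempty subspaces endowed with $C^\infty$ manifold structures (without boundary, of finite dimension, compatible with the subspace topologies); for example, strata of compact Thom–Mather stratifications $L,L'$. Put $\mathbb{R}_+=(0,\infty)$, $M=N\times\mathbb{R}_+\subset c(L)$ and $M'=N'\times\mathbb{R}_+\subset c(L')$, where $(x,r)$ is identified with $[x,r]$, and let $\rho,\rho'$ be the radial functions of $c(L),c(L')$. Let $h:[0,\infty)^2\to[0,\infty)$ be continuous, homogeneous of degree one, $C^\infty$ on $\mathbb{R}_+^2$, with $h^{-1}(0)=\{(0,0)\}$, and such that for some $C>1$ we have $h(r,r')=\max\{r,r'\}$ whenever $C\min\{r,r'\}<\max\{r,r'\}$. Let $L''=\{(a,a')\in c(L)\times c(L') : h(\rho(a),\rho'(a'))=1\}$, let $*''$ and $\rho''$ be the vertex and radial function of $c(L'')$, and let $$\phi:c(L'')\to c(L)\times c(L'),\qquad [([x,r],[x',r']),s]\mapsto([x,rs],[x',r's]).$$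 Let $N''=(M\times M')\cap L''$, with its structure of embedded submanifold (a hypersurface) of $M\times M'$, and $M''=N''\times\mathbb{R}_+\subset c(L'')$. Thus $\phi$ maps $M''$ into $M\times M'$. Let $u>0$, and let $\tilde g,\tilde g'$ be smooth Riemannian metrics on $N,N'$ (for example, general adapted metrics on strata). Put $$g=\rho^{2u}\tilde g+(d\rho)^2 \text{ on } M,\qquad g'=\rho'^{2u}\tilde g'+(d\rho')^2 \text{ on } M'.$$ Let $\tilde g''$ be a smooth Riemannian metric on $N''$ such that the inclusion $N''\hookrightarrow(M\times M',g+g')$ is quasi-isometric, i.e. $K^{-1}\tilde g''\le(g+g')|_{N''}\le K\tilde g''$ for some constant $K>0$ (for instance $\tilde g''=(g+g')|_{N''}$), and put $g''=\rho''^{2u}\tilde g''+(d\rho'')^2$ on $M''$. Equip $M\times M'$ with $g+g'$ and $M''$ with $g''$. A quasi-isometry $f:(S,g_1)\to(T,g_2)$ is a diffeomorphism with $K^{-1}g_1\le f^*g_2\le K g_1$ for some constant $K>0$. **Proposition 2.1.** The map $\phi$ restricts to a diffeomorphism $M''\to M\times M'$. Moreover: (i) If $u=1$, then $\phi:M''\to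 M\times M'$ is a quasi-isometry. (ii) If $u<1$, then $\phi:M''\cap O\to(M\times M')\cap\phi(O)$ is not a quasi-isometry for any neighborhood $O$ of $*''$ in $c(L'')$. -/

import Mathlib

open Set Topology Bundle
open scoped Manifold ContDiff NNReal

/-! ### Cones -/

/-- The relation on `(L × [0,∞)) ⊔ {*}` that collapses `L × {0}` to the vertex `*`. -/
inductive ConeRel (L : Type*) : (L × ℝ≥0) ⊕ Unit → (L × ℝ≥0) ⊕ Unit → Prop
  | collapse (x : L) : ConeRel L (Sum.inl (x, 0)) (Sum.inr ())

/-- The cone `c(L) = (L × [0,∞)) / (L × {0})`, with the quotient topology. The vertex is added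
explicitly, so that also `c(∅) = {*}`; for nonempty `L` this is the usual quotient. -/
def Cone (L : Type*) : Type _ := Quot (ConeRel L)

namespace Cone

variable {L : Type*}

instance [TopologicalSpace L] : TopologicalSpace (Cone L) :=
  inferInstanceAs (TopologicalSpace (Quot (ConeRel L)))

/-- The point `[x, r]` of the cone. -/
def mk (x : L) (r : ℝ≥0) : Cone L := Quot.mk _ (Sum.inl (x, r))

/-- The vertex `*` of the cone. -/
def vertex : Cone L := Quot.mk _ (Sum.inr ())

theorem mk_zero (x : L) : mk x 0 = vertex := Quot.sound (ConeRel.collapse x)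

/-- The radial function `[x, r] ↦ r`. -/
def radius : Cone L → ℝ≥0 :=
  Quot.lift (Sum.elim (fun p => p.2) fun _ => 0) (by rintro _ _ ⟨x⟩; rfl)

/-- The dilation `[x, r] ↦ [x, r s]` of the cone. -/
def dilate (s : ℝ≥0) : Cone L → Cone L :=
  Quot.lift (Sum.elim (fun p => mk p.1 (p.2 * s)) fun _ => vertex)
    (by rintro _ _ ⟨x⟩; simpa using mk_zero x)

@[simp] theorem radius_mk (x : L) (r : ℝ≥0) : radius (mk x r) = r := rfl

@[simp] theorem dilate_mk (s : ℝ≥0) (x : L) (r : ℝ≥0) :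
    dilate s (mk x r) = mk x (r * s) := rfl

theorem dilate_zero (a : Cone L) : dilate 0 a = vertex := by
  rcases a with ⟨⟨x, r⟩ | _⟩
  · change mk x (r * 0) = vertex
    rw [mul_zero, mk_zero]
  · rfl

end Cone

/-! ### The product of two cones as a cone -/

/-- The functions `h : [0,∞)² → [0,∞)` used to describe a product of two cones as a cone. Only the
values of `h` on the closed quadrant are relevant. -/
structure IsProductRadius (h : ℝ → ℝ → ℝ) : Prop where
  nonneg : ∀ r r' : ℝ, 0 ≤ r → 0 ≤ r' → 0 ≤ h r r'
  continuousOn : ContinuousOn (fun p : ℝ × ℝ => h p.1 p.2) (Ici 0 ×ˢ Ici 0)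
  homogeneous : ∀ s r r' : ℝ, 0 ≤ s → 0 ≤ r → 0 ≤ r' → h (s * r) (s * r') = s * h r r'
  contDiffOn : ContDiffOn ℝ ∞ (fun p : ℝ × ℝ => h p.1 p.2) (Ioi 0 ×ˢ Ioi 0)
  eq_zero_iff : ∀ r r' : ℝ, 0 ≤ r → 0 ≤ r' → (h r r' = 0 ↔ r = 0 ∧ r' = 0)
  eq_max : ∃ C : ℝ, 1 < C ∧ ∀ r r' : ℝ, 0 ≤ r → 0 ≤ r' →
    C * min r r' < max r r' → h r r' = max r r'

/-- The link `L'' = (h(ρ × ρ'))⁻¹(1) ⊆ c(L) × c(L')`. -/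
abbrev ProductLink (h : ℝ → ℝ → ℝ) (L L' : Type*) : Type _ :=
  {a : Cone L × Cone L' // h a.1.radius a.2.radius = 1}

/-- The map `φ : c(L'') → c(L) × c(L')`, `[([x, r], [x', r']), s] ↦ ([x, r s], [x', r' s])`. -/
def productConeMap (h : ℝ → ℝ → ℝ) (L L' : Type*) :
    Cone (ProductLink h L L') → Cone L × Cone L' :=
  Quot.lift
    (Sum.elim (fun p => (p.1.1.1.dilate p.2, p.1.1.2.dilate p.2))
      fun _ => (Cone.vertex, Cone.vertex))
    (by
      rintro _ _ ⟨a⟩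
      exact Prod.ext (Cone.dilate_zero _) (Cone.dilate_zero _))

/-! ### Strata -/

/-- `ℝ₊ = (0,∞)`, as an open submanifold of `ℝ`. -/
abbrev PosReal : TopologicalSpace.Opens ℝ := ⟨Ioi 0, isOpen_Ioi⟩

namespace PosReal

/-- The open submanifold structure, with the standard structure of `ℝ`. -/
noncomputable instance : ChartedSpace ℝ PosReal :=
  @TopologicalSpace.Opens.instChartedSpace ℝ ℝ _ _ (chartedSpaceSelf ℝ) PosReal

instance : IsManifold 𝓘(ℝ, ℝ) ∞ PosReal :=
  inferInstanceAs (@IsManifold _ _ _ _ _ _ _ 𝓘(ℝ, ℝ) ∞ PosReal _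
    (@TopologicalSpace.Opens.instChartedSpace ℝ ℝ _ _ (chartedSpaceSelf ℝ) PosReal))

/-- A point of `ℝ₊` as a nonnegative real number. -/
def toNNReal (r : PosReal) : ℝ≥0 := ⟨r.1, le_of_lt (mem_Ioi.1 r.2)⟩

/-- The product of two points of `ℝ₊`. -/
def mul (r s : PosReal) : PosReal := ⟨r.1 * s.1, mul_pos (mem_Ioi.1 r.2) (mem_Ioi.1 s.2)⟩

end PosReal

/-- The inclusion `N × ℝ₊ → c(L)`, `(x, r) ↦ [x, r]`, of the stratum of `c(L)` defined by a stratum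
`N` of `L`. -/
def coneStratumIncl {L : Type*} (N : Set L) (p : N × PosReal) : Cone L :=
  Cone.mk p.1.1 (PosReal.toNNReal p.2)

/-- The inclusion `M × M' → c(L) × c(L')`, where `M = N × ℝ₊` and `M' = N' × ℝ₊`. -/
def productStratumIncl {L L' : Type*} (N : Set L) (N' : Set L')
    (q : (N × PosReal) × (N' × PosReal)) : Cone L × Cone L' :=
  (coneStratumIncl N q.1, coneStratumIncl N' q.2)

/-- The stratum `N'' = (M × M') ∩ L''` of `L''`, as a subset of `M × M'`. -/
def linkStratum (h : ℝ → ℝ → ℝ) {L L' : Type*} (N : Set L) (N' : Set L') :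
    Set ((N × PosReal) × (N' × PosReal)) :=
  {q | h q.1.2 q.2.2 = 1}

/-- The inclusion `N'' → L''`. -/
def linkStratumIncl (h : ℝ → ℝ → ℝ) {L L' : Type*} (N : Set L) (N' : Set L')
    (q : linkStratum h N N') : ProductLink h L L' :=
  ⟨productStratumIncl N N' q.1, q.2⟩

/-- The inclusion `M'' = N'' × ℝ₊ → c(L'')`. -/
def linkConeStratumIncl (h : ℝ → ℝ → ℝ) {L L' : Type*} (N : Set L) (N' : Set L')
    (p : linkStratum h N N' × PosReal) : Cone (ProductLink h L L') :=
  Cone.mk (linkStratumIncl h N N' p.1) (PosReal.toNNReal p.2)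

/-- The restriction `φ : M'' → M × M'`, `((x, r, x', r'), s) ↦ (x, r s, x', r' s)`. -/
def stratumMap (h : ℝ → ℝ → ℝ) {L L' : Type*} (N : Set L) (N' : Set L')
    (p : linkStratum h N N' × PosReal) : (N × PosReal) × (N' × PosReal) :=
  ((p.1.1.1.1, PosReal.mul p.1.1.1.2 p.2), (p.1.1.2.1, PosReal.mul p.1.1.2.2 p.2))

/-- `stratumMap` is the restriction of `φ : c(L'') → c(L) × c(L')` to `M''`. -/
theorem productConeMap_linkConeStratumIncl (h : ℝ → ℝ → ℝ) {L L' : Type*} (N : Set L)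
    (N' : Set L') (p : linkStratum h N N' × PosReal) :
    productConeMap h L L' (linkConeStratumIncl h N N' p)
      = productStratumIncl N N' (stratumMap h N N' p) := rfl

/-- The model of the manifold `N × ℝ₊`, where `dim N = n`. -/
noncomputable abbrev coneModel (n : ℕ) :
    ModelWithCorners ℝ (EuclideanSpace ℝ (Fin n) × ℝ) (ModelProd (EuclideanSpace ℝ (Fin n)) ℝ) :=
  (𝓡 n).prod 𝓘(ℝ, ℝ)

/-- The model of the manifold `M × M' = (N × ℝ₊) × (N' × ℝ₊)`, where `dim N = n`, `dim N' = n'`. -/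
noncomputable abbrev prodConeModel (n n' : ℕ) :
    ModelWithCorners ℝ
      ((EuclideanSpace ℝ (Fin n) × ℝ) × (EuclideanSpace ℝ (Fin n') × ℝ))
      (ModelProd (ModelProd (EuclideanSpace ℝ (Fin n)) ℝ)
        (ModelProd (EuclideanSpace ℝ (Fin n')) ℝ)) :=
  (coneModel n).prod (coneModel n')

/-! ### Metrics and quasi-isometries -/

section Metrics

variable {E : Type*} [NormedAddCommGroup E] [NormedSpace ℝ E] {H : Type*} [TopologicalSpace H]
  {E' : Type*} [NormedAddCommGroup E'] [NormedSpace ℝ E'] {H' : Type*} [TopologicalSpace H']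

/-- A field of bilinear forms on the tangent spaces of a manifold. -/
abbrev BilinField (I : ModelWithCorners ℝ E H) (M : Type*) [TopologicalSpace M]
    [ChartedSpace H M] : Type _ :=
  ∀ p : M, LinearMap.BilinForm ℝ (TangentSpace I p)

/-- The smooth Riemannian metrics on a manifold. -/
abbrev RiemMetric (I : ModelWithCorners ℝ E H) (M : Type*) [TopologicalSpace M]
    [ChartedSpace H M] [IsManifold I ∞ M] : Type _ :=
  ContMDiffRiemannianMetric I ∞ E (fun p : M => TangentSpace I p)

/-- The inner products on the tangent spaces given by a Riemannian metric. -/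
noncomputable def RiemMetric.form {I : ModelWithCorners ℝ E H} {M : Type*} [TopologicalSpace M]
    [ChartedSpace H M] [IsManifold I ∞ M] (g : RiemMetric I M) : BilinField I M :=
  fun p => LinearMap.mk₂ ℝ (fun v w => g.inner p v w) (by simp) (by simp) (by simp) (by simp)

variable (I : ModelWithCorners ℝ E H) {M : Type*} [TopologicalSpace M] [ChartedSpace H M]
  (I' : ModelWithCorners ℝ E' H') {M' : Type*} [TopologicalSpace M'] [ChartedSpace H' M']

/-- The pull-back `f^* g` of a field of bilinear forms. -/
noncomputable def pullbackForm (f : M → M') (g : BilinField I' M') : BilinField I M :=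
  fun p => (g (f p)).compl₁₂ (mfderiv I I' f p).toLinearMap (mfderiv I I' f p).toLinearMap

/-- The square `(df)²` of the differential of a real function. -/
noncomputable def diffSq (f : M → ℝ) : BilinField I M :=
  fun p => LinearMap.BilinForm.linMulLin
    (mfderiv I 𝓘(ℝ, ℝ) f p).toLinearMap (mfderiv I 𝓘(ℝ, ℝ) f p).toLinearMap

/-- The metric `ρ^{2u} g̃ + (dρ)²` on `M × ℝ₊`, where `ρ` is the second projection. -/
noncomputable def coneMetric (u : ℝ) (g : BilinField I M) :
    BilinField (I.prod 𝓘(ℝ, ℝ)) (M × PosReal) :=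
  fun p => ((p.2 : ℝ) ^ (2 * u)) • pullbackForm (I.prod 𝓘(ℝ, ℝ)) I Prod.fst g p
    + diffSq (I.prod 𝓘(ℝ, ℝ)) (fun q : M × PosReal => (q.2 : ℝ)) p

/-- The product metric `g + g'` on `M × M'`. -/
noncomputable def prodMetric (g : BilinField I M) (g' : BilinField I' M') :
    BilinField (I.prod I') (M × M') :=
  fun p => pullbackForm (I.prod I') I Prod.fst g p + pullbackForm (I.prod I') I' Prod.snd g' p

/-- On `S`, the fields of forms `g₁` and `g₂` are bounded by constant multiples of each other. -/
def QuasiIsometricOn (S : Set M) (g₁ g₂ : BilinField I M) : Prop :=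
  ∃ K : ℝ, 0 < K ∧ ∀ p ∈ S, ∀ v : TangentSpace I p,
    K⁻¹ * g₁ p v v ≤ g₂ p v v ∧ g₂ p v v ≤ K * g₁ p v v

/-- `f` restricts to a smooth diffeomorphism of `S` onto `T`. -/
def IsDiffeoOn (f : M → M') (S : Set M) (T : Set M') : Prop :=
  ContMDiffOn I I' ∞ f S ∧ BijOn f S T ∧
    ∃ f' : M' → M, InvOn f' f S T ∧ ContMDiffOn I' I ∞ f' T

/-- `f` restricts to a quasi-isometry `(S, g) → (T, g')`: a diffeomorphism such that
`K⁻¹ g ≤ f^* g' ≤ K g` for some constant `K > 0`. -/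
def IsQuasiIsometryOn (f : M → M') (S : Set M) (T : Set M') (g : BilinField I M)
    (g' : BilinField I' M') : Prop :=
  IsDiffeoOn I I' f S T ∧ QuasiIsometricOn I S g (pullbackForm I I' f g')

end Metrics

/-- The metric `g + g'` on `M × M'`, where `g = ρ^{2u} g̃ + (dρ)²` and `g' = ρ'^{2u} g̃' + (dρ')²`. -/
noncomputable def sumConeMetric {n n' : ℕ} {P P' : Type*}
    [TopologicalSpace P] [ChartedSpace (EuclideanSpace ℝ (Fin n)) P]
    [TopologicalSpace P'] [ChartedSpace (EuclideanSpace ℝ (Fin n')) P']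
    (u : ℝ) (g : BilinField (𝓡 n) P) (g' : BilinField (𝓡 n') P') :
    BilinField (prodConeModel n n') ((P × PosReal) × (P' × PosReal)) :=
  prodMetric (coneModel n) (coneModel n') (coneMetric (𝓡 n) u g) (coneMetric (𝓡 n') u g')

/-!
The map `φ : M'' → M × M'` has the inverse `(x, t, x', t') ↦ ((x, t / s, x', t' / s), s)` with
`s = h(t, t')`, because `h` is homogeneous of degree one and equals `1` on `N''`. The inverse is
smooth since maps into the embedded submanifold `N''` are smooth when their composition with the
inclusion into `M × M'` is (`isDiffeoOn_stratumMap`).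

For the metrics, let `(w, σ)` be tangent to `M'' = N'' × ℝ₊` at `((x, r, x', r'), s)`, let `a, a'` be
the squared lengths of the components of `w` along `N, N'`, and `α, α'` its components along
`ρ, ρ'`. Then (`pullbackForm_stratumMap_self`)
`φ^*(g + g') = (r s)^{2u} a + (r σ + s α)² + (r' s)^{2u} a' + (r' σ + s α')²`, while
`g'' = s^{2u} g̃''(w, w) + σ²` and `g̃''(w, w)` is comparable with
`r^{2u} a + α² + r'^{2u} a' + α'²`.

If `u = 1`, the two are comparable as soon as `r, r'` are bounded and `|σ|` is bounded by a multiple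
of `|r σ + s α| + |r' σ + s α'|` (`cone_comparison`). The first holds because `h` dominates a multiple
of the maximum (`IsProductRadius.exists_max_le_mul`). For the second, `h(ρ, ρ') ∘ φ = ρ''` shows that
`σ` is the image of `(r σ + s α, r' σ + s α')` under `dh` (`mfderiv_radius_eq_fderiv`), and `dh` is
bounded on the open quadrant (`IsProductRadius.exists_norm_fderiv_le`): it is homogeneous of degree
zero, and constant near the sides of the quadrant, where `h` is one of the coordinates.

If `u < 1`, count dimensions: `N''` has dimension `n + n' + 1`, so it has a tangent vector `w ≠ 0`
without components along `N` and `N'` (`exists_ne_zero_mfderiv_eq_zero`). On `(w, 0)` the form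
`φ^*(g + g')` is `s² (α² + α'²)` and `g''` is `s^{2u} g̃''(w, w)`, and the quotient of the latter by
the former is unbounded as `s → 0`.
-/

/-! ### Homogeneous functions on the quadrant -/

namespace IsProductRadius

variable {h : ℝ → ℝ → ℝ}

theorem pos (hh : IsProductRadius h) {r r' : ℝ} (hr : 0 < r) (hr' : 0 < r') : 0 < h r r' :=
  lt_of_le_of_ne (hh.nonneg r r' hr.le hr'.le) fun h0 =>
    hr.ne' ((hh.eq_zero_iff r r' hr.le hr'.le).1 h0.symm).1

/-- `h` dominates a multiple of the maximum: by homogeneity, the factor can be taken to be its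
minimum on the part of the quadrant where `max r r' = 1`, which is compact. -/
theorem exists_max_le_mul (hh : IsProductRadius h) :
    ∃ R : ℝ, 0 < R ∧ ∀ r r' : ℝ, 0 ≤ r → 0 ≤ r' → max r r' ≤ R * h r r' := by
  have hK : IsCompact ((Icc (0 : ℝ) 1 ×ˢ Icc (0 : ℝ) 1) ∩ {p : ℝ × ℝ | max p.1 p.2 = 1}) :=
    (isCompact_Icc.prod isCompact_Icc).inter_right
      (isClosed_eq (continuous_fst.max continuous_snd) continuous_const)
  obtain ⟨p, ⟨⟨hp1, hp2⟩, hpm⟩, hmin⟩ := hK.exists_isMinOn ⟨(1, 1), by simp⟩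
    (hh.continuousOn.mono fun p hp => ⟨hp.1.1.1, hp.1.2.1⟩)
  have hc : 0 < h p.1 p.2 := by
    refine lt_of_le_of_ne (hh.nonneg _ _ hp1.1 hp2.1) fun h0 => ?_
    obtain ⟨h1, h2⟩ := (hh.eq_zero_iff _ _ hp1.1 hp2.1).1 h0.symm
    have : max p.1 p.2 = 1 := hpm
    simp [h1, h2] at this
  refine ⟨(h p.1 p.2)⁻¹, inv_pos.2 hc, fun r r' hr hr' => ?_⟩
  rw [inv_mul_eq_div, le_div_iff₀ hc]
  rcases (le_max_of_le_left hr : 0 ≤ max r r').eq_or_lt with hm | hm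
  · rw [← hm, zero_mul]
    exact hh.nonneg r r' hr hr'
  set m := max r r' with hmdef
  have key : h p.1 p.2 ≤ h (m⁻¹ * r) (m⁻¹ * r') := by
    refine hmin (a := (m⁻¹ * r, m⁻¹ * r')) ⟨⟨⟨by positivity, ?_⟩, ⟨by positivity, ?_⟩⟩, ?_⟩
    · rw [inv_mul_eq_div]; exact div_le_one_of_le₀ (le_max_left _ _) hm.le
    · change m⁻¹ * r' ≤ 1
      rw [inv_mul_eq_div]; exact div_le_one_of_le₀ (le_max_right _ _) hm.le
    · change max (m⁻¹ * r) (m⁻¹ * r') = 1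
      rw [← mul_max_of_nonneg _ _ (inv_nonneg.2 hm.le), ← hmdef, inv_mul_cancel₀ hm.ne']
  rw [hh.homogeneous _ _ _ (inv_nonneg.2 hm.le) hr hr', inv_mul_eq_div, le_div_iff₀ hm] at key
  linarith

theorem isOpen_quadrant : IsOpen (Ioi (0 : ℝ) ×ˢ Ioi (0 : ℝ)) := isOpen_Ioi.prod isOpen_Ioi

theorem differentiableAt (hh : IsProductRadius h) {p : ℝ × ℝ}
    (hp : p ∈ Ioi (0 : ℝ) ×ˢ Ioi (0 : ℝ)) :
    DifferentiableAt ℝ (fun p : ℝ × ℝ => h p.1 p.2) p :=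
  (hh.contDiffOn.contDiffAt (isOpen_quadrant.mem_nhds hp)).differentiableAt (by simp)

/-- The differential of a function homogeneous of degree one is homogeneous of degree zero. -/
theorem fderiv_smul (hh : IsProductRadius h) {s : ℝ} (hs : 0 < s) {p : ℝ × ℝ}
    (hp : p ∈ Ioi (0 : ℝ) ×ˢ Ioi (0 : ℝ)) :
    fderiv ℝ (fun p : ℝ × ℝ => h p.1 p.2) (s • p) = fderiv ℝ (fun p : ℝ × ℝ => h p.1 p.2) p := by
  have e : (fun q : ℝ × ℝ => h (s • q).1 (s • q).2) =ᶠ[𝓝 p] fun q => s • h q.1 q.2 := by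
    filter_upwards [isOpen_quadrant.mem_nhds hp] with q hq
    exact hh.homogeneous s q.1 q.2 hs.le (le_of_lt hq.1) (le_of_lt hq.2)
  have e1 := e.fderiv_eq (𝕜 := ℝ)
  rw [fderiv_fun_const_smul (hh.differentiableAt hp)] at e1
  have e2 := fderiv_comp_smul (𝕜 := ℝ) (f := fun p : ℝ × ℝ => h p.1 p.2) (c := s) (x := p)
  exact smul_right_injective _ hs.ne' (e2.symm.trans e1)

/-- The differential of `h` is bounded on the open quadrant. -/
theorem exists_norm_fderiv_le (hh : IsProductRadius h) :
    ∃ B : ℝ, 0 < B ∧ ∀ p ∈ Ioi (0 : ℝ) ×ˢ Ioi (0 : ℝ),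
      ‖fderiv ℝ (fun p : ℝ × ℝ => h p.1 p.2) p‖ ≤ B := by
  obtain ⟨C, hC, hmax⟩ := hh.eq_max
  have hC0 : 0 < C := zero_lt_one.trans hC
  have hsub : Icc C⁻¹ 1 ×ˢ Icc C⁻¹ 1 ⊆ Ioi (0 : ℝ) ×ˢ Ioi (0 : ℝ) := fun p hp =>
    ⟨(inv_pos.2 hC0).trans_le hp.1.1, (inv_pos.2 hC0).trans_le hp.2.1⟩
  obtain ⟨B, hB⟩ := (isCompact_Icc.prod isCompact_Icc).exists_bound_of_continuousOn
    ((hh.contDiffOn.continuousOn_fderiv_of_isOpen isOpen_quadrant (by simp)).mono hsub)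
  refine ⟨max B 1, lt_max_of_lt_right one_pos, fun p hp => ?_⟩
  have hp1 : 0 < p.1 := hp.1
  have hp2 : 0 < p.2 := hp.2
  have hev : C * min p.1 p.2 < max p.1 p.2 → ∀ᶠ q in 𝓝 p, h q.1 q.2 = max q.1 q.2 := by
    intro hlt
    have ho : IsOpen {q : ℝ × ℝ | C * min q.1 q.2 < max q.1 q.2} :=
      isOpen_lt (by fun_prop) (by fun_prop)
    filter_upwards [ho.mem_nhds hlt, isOpen_quadrant.mem_nhds hp] with q hq hq'
    exact hmax q.1 q.2 (le_of_lt hq'.1) (le_of_lt hq'.2) hq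
  by_cases hlt : C * min p.1 p.2 < max p.1 p.2
  · -- near the boundary of the quadrant, `h` is one of the two coordinates
    refine le_max_of_le_right ?_
    rcases lt_trichotomy p.1 p.2 with hl | hl | hl
    · have e : (fun q : ℝ × ℝ => h q.1 q.2) =ᶠ[𝓝 p] Prod.snd := by
        filter_upwards [hev hlt, (isOpen_lt continuous_fst continuous_snd).mem_nhds hl]
          with q hq hq'
        rw [hq, max_eq_right (le_of_lt hq')]
      rw [e.fderiv_eq, fderiv_snd]
      exact ContinuousLinearMap.norm_snd_le ..
    · simp only [hl, min_self, max_self] at hlt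
      nlinarith
    · have e : (fun q : ℝ × ℝ => h q.1 q.2) =ᶠ[𝓝 p] Prod.fst := by
        filter_upwards [hev hlt, (isOpen_lt continuous_snd continuous_fst).mem_nhds hl]
          with q hq hq'
        rw [hq, max_eq_left (le_of_lt hq')]
      rw [e.fderiv_eq, fderiv_fst]
      exact ContinuousLinearMap.norm_fst_le ..
  · -- elsewhere, dilate `p` into a compact subset of the open quadrant
    rw [not_lt] at hlt
    have hm : 0 < max p.1 p.2 := lt_max_of_lt_left hp1
    rw [← hh.fderiv_smul (inv_pos.2 hm) hp]
    have h1 : max p.1 p.2 ≤ C * p.1 := hlt.trans (by gcongr; exact min_le_left _ _)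
    have h2 : max p.1 p.2 ≤ C * p.2 := hlt.trans (by gcongr; exact min_le_right _ _)
    refine le_max_of_le_left (hB _ ⟨⟨?_, ?_⟩, ⟨?_, ?_⟩⟩) <;>
      simp only [Prod.smul_fst, Prod.smul_snd, smul_eq_mul, inv_mul_eq_div]
    · rw [le_div_iff₀ hm, inv_mul_le_iff₀ hC0]; exact h1
    · exact div_le_one_of_le₀ (le_max_left _ _) hm.le
    · rw [le_div_iff₀ hm, inv_mul_le_iff₀ hC0]; exact h2
    · exact div_le_one_of_le₀ (le_max_right _ _) hm.le

end IsProductRadius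

/-! ### Numerical estimates -/

/-- The estimate behind the case `u = 1`. Here `a, a'` stand for the squared lengths of the
components of a vector tangent to `N''` along `N, N'`, `α, α'` for its components along `ρ, ρ'`, `q`
for its squared length, and `σ` for the component along `ρ''`. The bound on `|σ|` is what makes
the lower estimate possible. -/
theorem cone_comparison {K₀ R B r r' s a a' α α' σ q : ℝ} (hK₀ : 0 < K₀)
    (hr : 0 < r) (hr' : 0 < r') (hrR : r ≤ R) (hrR' : r' ≤ R) (ha : 0 ≤ a) (ha' : 0 ≤ a')
    (hσ : |σ| ≤ B * (|r * σ + s * α| + |r' * σ + s * α'|))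
    (h1 : K₀⁻¹ * q ≤ (r ^ 2 * a + α ^ 2) + (r' ^ 2 * a' + α' ^ 2))
    (h2 : (r ^ 2 * a + α ^ 2) + (r' ^ 2 * a' + α' ^ 2) ≤ K₀ * q) :
    let K := 2 * K₀ + 4 * R ^ 2 + (K₀ * (2 + 8 * R ^ 2 * B ^ 2) + 2 * B ^ 2)
    K⁻¹ * (s ^ 2 * q + σ ^ 2) ≤
        ((r * s) ^ 2 * a + (r * σ + s * α) ^ 2) +
          ((r' * s) ^ 2 * a' + (r' * σ + s * α') ^ 2) ∧
      ((r * s) ^ 2 * a + (r * σ + s * α) ^ 2) +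
          ((r' * s) ^ 2 * a' + (r' * σ + s * α') ^ 2) ≤ K * (s ^ 2 * q + σ ^ 2) := by
  intro K
  have hK : 0 < K := by positivity
  rw [inv_mul_le_iff₀ hK₀] at h1
  have hrσ : r ^ 2 * σ ^ 2 ≤ R ^ 2 * σ ^ 2 := by gcongr
  have hrσ' : r' ^ 2 * σ ^ 2 ≤ R ^ 2 * σ ^ 2 := by gcongr
  have hx : 0 ≤ s ^ 2 * (r ^ 2 * a) := by positivity
  have hx' : 0 ≤ s ^ 2 * (r' ^ 2 * a') := by positivity
  set w := r * σ + s * α with hw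
  set w' := r' * σ + s * α' with hw'
  have e1 := mul_le_mul_of_nonneg_left h1 (sq_nonneg s)
  have e2 := mul_le_mul_of_nonneg_left h2 (sq_nonneg s)
  have eσ : σ ^ 2 ≤ 2 * B ^ 2 * (w ^ 2 + w' ^ 2) := by
    calc σ ^ 2 = |σ| ^ 2 := (sq_abs σ).symm
      _ ≤ (B * (|w| + |w'|)) ^ 2 := by gcongr
      _ = B ^ 2 * (|w| + |w'|) ^ 2 := by ring
      _ ≤ B ^ 2 * (2 * (|w| ^ 2 + |w'| ^ 2)) := by gcongr; exact add_sq_le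
      _ = 2 * B ^ 2 * (w ^ 2 + w' ^ 2) := by rw [sq_abs, sq_abs]; ring
  -- since `s α = (r σ + s α) - r σ`
  have eα : s ^ 2 * α ^ 2 ≤ 2 * w ^ 2 + 2 * (R ^ 2 * σ ^ 2) := by
    have : s ^ 2 * α ^ 2 + (w + r * σ) ^ 2 = 2 * w ^ 2 + 2 * (r ^ 2 * σ ^ 2) := by rw [hw]; ring
    linarith [sq_nonneg (w + r * σ)]
  have eα' : s ^ 2 * α' ^ 2 ≤ 2 * w' ^ 2 + 2 * (R ^ 2 * σ ^ 2) := by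
    have : s ^ 2 * α' ^ 2 + (w' + r' * σ) ^ 2 = 2 * w' ^ 2 + 2 * (r' ^ 2 * σ ^ 2) := by
      rw [hw']; ring
    linarith [sq_nonneg (w' + r' * σ)]
  have ew : w ^ 2 ≤ 2 * (R ^ 2 * σ ^ 2) + 2 * (s ^ 2 * α ^ 2) := by
    have : w ^ 2 + (r * σ - s * α) ^ 2 = 2 * (r ^ 2 * σ ^ 2) + 2 * (s ^ 2 * α ^ 2) := by
      rw [hw]; ring
    linarith [sq_nonneg (r * σ - s * α)]
  have ew' : w' ^ 2 ≤ 2 * (R ^ 2 * σ ^ 2) + 2 * (s ^ 2 * α' ^ 2) := by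
    have : w' ^ 2 + (r' * σ - s * α') ^ 2 = 2 * (r' ^ 2 * σ ^ 2) + 2 * (s ^ 2 * α' ^ 2) := by
      rw [hw']; ring
    linarith [sq_nonneg (r' * σ - s * α')]
  have hT : 0 ≤ (r ^ 2 * a + α ^ 2) + (r' ^ 2 * a' + α' ^ 2) := by positivity
  have hq : 0 ≤ K₀ * q := hT.trans h2
  have hsq : 0 ≤ s ^ 2 * q := mul_nonneg (sq_nonneg s) ((mul_nonneg_iff_of_pos_left hK₀).1 hq)
  set W := (r * s) ^ 2 * a + w ^ 2 + ((r' * s) ^ 2 * a' + w' ^ 2) with hW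
  have hWeq : W = s ^ 2 * (r ^ 2 * a) + w ^ 2 + (s ^ 2 * (r' ^ 2 * a') + w' ^ 2) := by
    rw [hW]; ring
  have hW0 : 0 ≤ W := by positivity
  have hK1 : 0 ≤ 2 * K₀ + 4 * R ^ 2 := by positivity
  have hK2 : 0 ≤ K₀ * (2 + 8 * R ^ 2 * B ^ 2) + 2 * B ^ 2 := by positivity
  constructor
  · have hww : w ^ 2 + w' ^ 2 ≤ W := by rw [hWeq]; linarith
    have eσW : σ ^ 2 ≤ 2 * B ^ 2 * W := eσ.trans (by gcongr)
    have hRσ : R ^ 2 * σ ^ 2 ≤ R ^ 2 * (2 * B ^ 2 * W) := by gcongr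
    have hsT : s ^ 2 * ((r ^ 2 * a + α ^ 2) + (r' ^ 2 * a' + α' ^ 2)) ≤
        (2 + 8 * R ^ 2 * B ^ 2) * W := by
      linarith
    have hsqW := mul_le_mul_of_nonneg_left hsT hK₀.le
    rw [inv_mul_le_iff₀ hK]
    have : s ^ 2 * q + σ ^ 2 ≤ (K₀ * (2 + 8 * R ^ 2 * B ^ 2) + 2 * B ^ 2) * W := by linarith
    exact this.trans (mul_le_mul_of_nonneg_right (le_add_of_nonneg_left hK1) hW0)
  · have h3 := mul_nonneg (sq_nonneg R) hsq
    have h4 := mul_nonneg hK₀.le (sq_nonneg σ)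
    have : W ≤ (2 * K₀ + 4 * R ^ 2) * (s ^ 2 * q + σ ^ 2) := by linarith
    exact this.trans (mul_le_mul_of_nonneg_right (le_add_of_nonneg_right hK2)
      (add_nonneg hsq (sq_nonneg σ)))

/-- As `s → 0`, the function `s ^ (2 * u)` is not dominated by `s ^ 2` if `u < 1`. -/
theorem not_rpow_le_sq_eventually {u K G A : ℝ} (hu : u < 1) (hK : 0 < K) (hG : 0 < G) :
    ¬ ∀ᶠ s : ℝ in 𝓝[>] 0, K⁻¹ * (s ^ (2 * u) * G) ≤ s ^ 2 * A := by
  intro hev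
  have hlim : Filter.Tendsto (fun s : ℝ => s ^ (2 - 2 * u) * (K * A)) (𝓝[>] 0) (𝓝 0) := by
    have h0 : ContinuousAt (fun s : ℝ => s ^ (2 - 2 * u) * (K * A)) 0 :=
      (Real.continuousAt_rpow_const 0 _ (Or.inr (by linarith))).mul continuousAt_const
    have h1 := h0.tendsto
    rw [Real.zero_rpow (by linarith), zero_mul] at h1
    exact h1.mono_left nhdsWithin_le_nhds
  refine hG.not_ge (ge_of_tendsto hlim ?_)
  filter_upwards [hev, self_mem_nhdsWithin] with s hs hs0
  have hs0 : 0 < s := hs0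
  have hp : 0 < s ^ (2 * u) := Real.rpow_pos_of_pos hs0 _
  rw [inv_mul_le_iff₀ hK] at hs
  have e : s ^ 2 = s ^ (2 * u) * s ^ (2 - 2 * u) := by
    rw [← Real.rpow_add hs0, ← Real.rpow_natCast]
    norm_num
  rw [e] at hs
  refine le_of_mul_le_mul_left ?_ hp
  linarith

/-! ### Neighborhoods of the vertex of a cone -/

theorem Cone.eventually_mk_mem {L : Type*} [TopologicalSpace L] (x : L) {O : Set (Cone L)}
    (hO : O ∈ 𝓝 (Cone.vertex : Cone L)) : ∀ᶠ s : ℝ in 𝓝[>] 0, Cone.mk x s.toNNReal ∈ O := by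
  have hc : Continuous fun s : ℝ => Cone.mk x s.toNNReal :=
    continuous_quot_mk.comp
      (continuous_inl.comp (continuous_const.prodMk continuous_real_toNNReal))
  have h0 : Cone.mk x (Real.toNNReal 0) = Cone.vertex := by rw [Real.toNNReal_zero, Cone.mk_zero]
  exact nhdsWithin_le_nhds (hc.continuousAt.preimage_mem_nhds (h0 ▸ hO))

/-! ### Pull-backs of cone metrics and product metrics -/

namespace PosReal

theorem contMDiff_coe : ContMDiff 𝓘(ℝ, ℝ) 𝓘(ℝ, ℝ) ∞ (fun r : PosReal => (r : ℝ)) :=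
  contMDiff_subtype_val

theorem contMDiff_mk {E : Type*} [NormedAddCommGroup E] [NormedSpace ℝ E] {H : Type*}
    [TopologicalSpace H] {I : ModelWithCorners ℝ E H} {X : Type*} [TopologicalSpace X]
    [ChartedSpace H X] {f : X → PosReal}
    (hf : ContMDiff I 𝓘(ℝ, ℝ) ∞ (fun x => (f x : ℝ))) : ContMDiff I 𝓘(ℝ, ℝ) ∞ f :=
  (ContMDiff.subtypeVal_comp_iff PosReal f).1 hf

end PosReal

section Pullback

variable {E : Type*} [NormedAddCommGroup E] [NormedSpace ℝ E] {H : Type*} [TopologicalSpace H]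
  {E' : Type*} [NormedAddCommGroup E'] [NormedSpace ℝ E'] {H' : Type*} [TopologicalSpace H']
  {F : Type*} [NormedAddCommGroup F] [NormedSpace ℝ F] {G : Type*} [TopologicalSpace G]
  {I : ModelWithCorners ℝ E H} {M : Type*} [TopologicalSpace M] [ChartedSpace H M]
  {I' : ModelWithCorners ℝ E' H'} {M' : Type*} [TopologicalSpace M'] [ChartedSpace H' M']
  {J : ModelWithCorners ℝ F G} {X : Type*} [TopologicalSpace X] [ChartedSpace G X]

theorem pullbackForm_prodMetric_self (g : BilinField I M) (g' : BilinField I' M')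
    {f : X → M × M'} {x : X} (hf : MDifferentiableAt J (I.prod I') f x) (v : TangentSpace J x) :
    pullbackForm J (I.prod I') f (prodMetric I I' g g') x v v =
      pullbackForm J I (fun y => (f y).1) g x v v +
        pullbackForm J I' (fun y => (f y).2) g' x v v := by
  have h1 := mfderiv_comp_apply x (mdifferentiableAt_fst (I := I) (I' := I') (x := f x)) hf v
  have h2 := mfderiv_comp_apply x (mdifferentiableAt_snd (I := I) (I' := I') (x := f x)) hf v
  change g (f x).1 _ _ + g' (f x).2 _ _ = g (f x).1 _ _ + g' (f x).2 _ _
  exact congrArg₂ (· + ·) (congrArg₂ (fun a b => g (f x).1 a b) h1.symm h1.symm)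
    (congrArg₂ (fun a b => g' (f x).2 a b) h2.symm h2.symm)

theorem pullbackForm_coneMetric_self (u : ℝ) (g : BilinField I M)
    {f : X → M × PosReal} {x : X} (hf : MDifferentiableAt J (I.prod 𝓘(ℝ, ℝ)) f x)
    (v : TangentSpace J x) :
    pullbackForm J (I.prod 𝓘(ℝ, ℝ)) f (coneMetric I u g) x v v =
      ((f x).2 : ℝ) ^ (2 * u) * pullbackForm J I (fun y => (f y).1) g x v v +
        (show ℝ from mfderiv J 𝓘(ℝ, ℝ) (fun y => ((f y).2 : ℝ)) x v) ^ 2 := by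
  have h1 := mfderiv_comp_apply x
    (mdifferentiableAt_fst (I := I) (I' := 𝓘(ℝ, ℝ)) (x := f x)) hf v
  have hρ : MDifferentiableAt (I.prod 𝓘(ℝ, ℝ)) 𝓘(ℝ, ℝ)
      (fun q : M × PosReal => (q.2 : ℝ)) (f x) :=
    ((PosReal.contMDiff_coe.comp contMDiff_snd).mdifferentiable (by simp)) _
  have h2 := mfderiv_comp_apply x hρ hf v
  rw [sq]
  change _ * g (f x).1 _ _ + (_ : ℝ) * _ = _ * g (f x).1 _ _ + _
  exact congrArg₂ (· + ·)
    (congrArg₂ (fun a b => ((f x).2 : ℝ) ^ (2 * u) * g (f x).1 a b) h1.symm h1.symm)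
    (congrArg₂ (fun a b : ℝ => a * b) h2.symm h2.symm)

theorem coneMetric_self (u : ℝ) (g : BilinField I M) (p : M × PosReal)
    (v : TangentSpace (I.prod 𝓘(ℝ, ℝ)) p) :
    coneMetric I u g p v v =
      (p.2 : ℝ) ^ (2 * u) * pullbackForm (I.prod 𝓘(ℝ, ℝ)) I Prod.fst g p v v +
        (show ℝ from mfderiv (I.prod 𝓘(ℝ, ℝ)) 𝓘(ℝ, ℝ)
          (fun q : M × PosReal => (q.2 : ℝ)) p v) ^ 2 := by
  rw [sq]
  rfl

theorem pullbackForm_comp_self {g : BilinField I' M'} {f : M → M'} {k : X → M} {x : X}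
    (hf : MDifferentiableAt I I' f (k x)) (hk : MDifferentiableAt J I k x)
    (v : TangentSpace J x) :
    pullbackForm J I' (fun y => f (k y)) g x v v =
      pullbackForm I I' f g (k x) (mfderiv J I k x v) (mfderiv J I k x v) := by
  have h1 := mfderiv_comp_apply x hf hk v
  exact congrArg₂ (fun a b => g (f (k x)) a b) h1 h1

theorem RiemMetric.form_self_nonneg [IsManifold I ∞ M] (g : RiemMetric I M) (p : M)
    (v : TangentSpace I p) : 0 ≤ g.form p v v := by
  by_cases hv : v = 0
  · simp [hv]
  · exact (g.pos p v hv).le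

/-- The product rule for `(x, s) ↦ f(x) s` on `M × ℝ₊`. -/
theorem mfderiv_mul_radius {f : M → ℝ} {p : M × PosReal}
    (hf : MDifferentiableAt I 𝓘(ℝ, ℝ) f p.1) (v : TangentSpace (I.prod 𝓘(ℝ, ℝ)) p) :
    (show ℝ from mfderiv (I.prod 𝓘(ℝ, ℝ)) 𝓘(ℝ, ℝ) (fun q : M × PosReal => f q.1 * q.2) p v) =
      f p.1 * (show ℝ from
          mfderiv (I.prod 𝓘(ℝ, ℝ)) 𝓘(ℝ, ℝ) (fun q : M × PosReal => (q.2 : ℝ)) p v) +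
        p.2 * (show ℝ from mfderiv I 𝓘(ℝ, ℝ) f p.1
          (mfderiv (I.prod 𝓘(ℝ, ℝ)) I Prod.fst p v)) := by
  have hfst := mdifferentiableAt_fst (I := I) (I' := 𝓘(ℝ, ℝ)) (x := p)
  have h1 : MDifferentiableAt (I.prod 𝓘(ℝ, ℝ)) 𝓘(ℝ, ℝ) (f ∘ Prod.fst) p := hf.comp p hfst
  have h2 : MDifferentiableAt (I.prod 𝓘(ℝ, ℝ)) 𝓘(ℝ, ℝ) (fun q : M × PosReal => (q.2 : ℝ)) p :=
    ((PosReal.contMDiff_coe.comp contMDiff_snd).mdifferentiable (by simp)) _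
  have h3 := (h1.hasMFDerivAt.mul h2.hasMFDerivAt).mfderiv
  have h4 := mfderiv_comp_apply p hf hfst v
  have h5 := congrArg (fun D : TangentSpace (I.prod 𝓘(ℝ, ℝ)) p →L[ℝ] ℝ => D v) h3
  refine h5.trans ?_
  exact congrArg (fun a : ℝ => f p.1 * (show ℝ from
          mfderiv (I.prod 𝓘(ℝ, ℝ)) 𝓘(ℝ, ℝ) (fun q : M × PosReal => (q.2 : ℝ)) p v) +
        (p.2 : ℝ) * a) h4

end Pullback

/-! ### The restriction of `φ` is a diffeomorphism -/

namespace PosReal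

/-- The inverse of a point of `ℝ₊`. -/
noncomputable def inv (r : PosReal) : PosReal := ⟨(r.1)⁻¹, inv_pos.2 (mem_Ioi.1 r.2)⟩

end PosReal

section LinkProjection

variable {L L' : Type*} {N : Set L} {N' : Set L'} {h : ℝ → ℝ → ℝ}

/-- The function `h(ρ, ρ')` on `M × M'`, which becomes the radial function of `M''` under `φ`. -/
def stratumRadius (hh : IsProductRadius h) (q : (N × PosReal) × (N' × PosReal)) : PosReal :=
  ⟨h q.1.2 q.2.2, hh.pos q.1.2.2 q.2.2.2⟩

/-- The projection `M × M' → N''` along the dilations, `(x, t, x', t') ↦ (x, t / s, x', t' / s)`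
with `s = h(t, t')`. -/
noncomputable def linkProj (hh : IsProductRadius h) (q : (N × PosReal) × (N' × PosReal)) :
    linkStratum h N N' :=
  ⟨((q.1.1, PosReal.mul (PosReal.inv (stratumRadius hh q)) q.1.2),
    (q.2.1, PosReal.mul (PosReal.inv (stratumRadius hh q)) q.2.2)), by
    have hs : 0 < (stratumRadius hh q : ℝ) := (stratumRadius hh q).2
    change h ((stratumRadius hh q : ℝ)⁻¹ * q.1.2) ((stratumRadius hh q : ℝ)⁻¹ * q.2.2) = 1
    rw [hh.homogeneous _ _ _ (inv_nonneg.2 hs.le) (le_of_lt q.1.2.2) (le_of_lt q.2.2.2)]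
    exact inv_mul_cancel₀ hs.ne'⟩

/-- The identity `h(ρ, ρ') ∘ φ = ρ''`. -/
theorem stratumRadius_stratumMap (hh : IsProductRadius h) (p : linkStratum h N N' × PosReal) :
    stratumRadius hh (stratumMap h N N' p) = p.2 := by
  apply Subtype.ext
  change h (p.1.1.1.2 * p.2) (p.1.1.2.2 * p.2) = p.2
  rw [mul_comm, mul_comm (p.1.1.2.2 : ℝ),
    hh.homogeneous _ _ _ (le_of_lt p.2.2) (le_of_lt p.1.1.1.2.2) (le_of_lt p.1.1.2.2.2)]
  have : h p.1.1.1.2 p.1.1.2.2 = 1 := p.1.2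
  rw [this, mul_one]

theorem linkProj_stratumMap (hh : IsProductRadius h) (p : linkStratum h N N' × PosReal) :
    linkProj hh (stratumMap h N N' p) = p.1 := by
  have hs : (p.2 : ℝ) ≠ 0 := ne_of_gt p.2.2
  refine Subtype.ext (Prod.ext (Prod.ext (by rfl) (Subtype.ext ?_))
    (Prod.ext (by rfl) (Subtype.ext ?_)))
  · change (stratumRadius hh (stratumMap h N N' p) : ℝ)⁻¹ * (p.1.1.1.2 * p.2) = p.1.1.1.2
    rw [stratumRadius_stratumMap]
    field_simp
  · change (stratumRadius hh (stratumMap h N N' p) : ℝ)⁻¹ * (p.1.1.2.2 * p.2) = p.1.1.2.2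
    rw [stratumRadius_stratumMap]
    field_simp

theorem stratumMap_linkProj (hh : IsProductRadius h) (q : (N × PosReal) × (N' × PosReal)) :
    stratumMap h N N' (linkProj hh q, stratumRadius hh q) = q := by
  have hs : (stratumRadius hh q : ℝ) ≠ 0 := ne_of_gt (stratumRadius hh q).2
  refine Prod.ext (Prod.ext (by rfl) (Subtype.ext ?_)) (Prod.ext (by rfl) (Subtype.ext ?_))
  · change (stratumRadius hh q : ℝ)⁻¹ * q.1.2 * (stratumRadius hh q : ℝ) = q.1.2
    field_simp
  · change (stratumRadius hh q : ℝ)⁻¹ * q.2.2 * (stratumRadius hh q : ℝ) = q.2.2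
    field_simp

end LinkProjection

section Stratum

variable {L L' : Type*} [TopologicalSpace L] [TopologicalSpace L'] {N : Set L} {N' : Set L'}
  {n n' m : ℕ}
  [ChartedSpace (EuclideanSpace ℝ (Fin n)) N] [ChartedSpace (EuclideanSpace ℝ (Fin n')) N']
  {h : ℝ → ℝ → ℝ} [ChartedSpace (EuclideanSpace ℝ (Fin m)) (linkStratum h N N')]

theorem contMDiff_stratumMap
    (hι : ContMDiff (𝓡 m) (prodConeModel n n') ∞
      (Subtype.val : linkStratum h N N' → (N × PosReal) × (N' × PosReal))) :
    ContMDiff (coneModel m) (prodConeModel n n') ∞ (stratumMap h N N') := by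
  have hf : ContMDiff (coneModel m) (prodConeModel n n') ∞
      (fun p : linkStratum h N N' × PosReal => p.1.1) := hι.comp contMDiff_fst
  have hs : ContMDiff (coneModel m) 𝓘(ℝ, ℝ) ∞
      (fun p : linkStratum h N N' × PosReal => (p.2 : ℝ)) :=
    PosReal.contMDiff_coe.comp contMDiff_snd
  have h1 := contMDiff_fst.comp hf
  have h2 := contMDiff_snd.comp hf
  refine ((contMDiff_fst.comp h1).prodMk (PosReal.contMDiff_mk ?_)).prodMk
    ((contMDiff_fst.comp h2).prodMk (PosReal.contMDiff_mk ?_))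
  · exact (PosReal.contMDiff_coe.comp (contMDiff_snd.comp h1)).mul hs
  · exact (PosReal.contMDiff_coe.comp (contMDiff_snd.comp h2)).mul hs

theorem contMDiff_stratumRadius (hh : IsProductRadius h) :
    ContMDiff (prodConeModel n n') 𝓘(ℝ, ℝ) ∞
      (stratumRadius hh : (N × PosReal) × (N' × PosReal) → PosReal) := by
  apply PosReal.contMDiff_mk
  have hρ : ContMDiff (prodConeModel n n') 𝓘(ℝ, ℝ × ℝ) ∞
      (fun q : (N × PosReal) × (N' × PosReal) => ((q.1.2 : ℝ), (q.2.2 : ℝ))) :=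
    (PosReal.contMDiff_coe.comp (contMDiff_snd.comp contMDiff_fst)).prodMk_space
      (PosReal.contMDiff_coe.comp (contMDiff_snd.comp contMDiff_snd))
  intro q
  have h1 : ContMDiffAt 𝓘(ℝ, ℝ × ℝ) 𝓘(ℝ, ℝ) ∞ (fun p : ℝ × ℝ => h p.1 p.2)
      ((q.1.2 : ℝ), (q.2.2 : ℝ)) :=
    (hh.contDiffOn.contDiffAt
      (IsProductRadius.isOpen_quadrant.mem_nhds ⟨q.1.2.2, q.2.2.2⟩)).contMDiffAt
  exact ContMDiffAt.comp (g := fun p : ℝ × ℝ => h p.1 p.2) q h1 (hρ q)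

/-- `φ` restricts to a diffeomorphism `M'' → M × M'`. Its inverse takes values in `N'' × ℝ₊`, and is
smooth because a continuous map into the embedded submanifold `N''` is smooth as soon as it is
smooth as a map into `M × M'`. -/
theorem isDiffeoOn_stratumMap (hh : IsProductRadius h) [IsManifold (𝓡 m) ∞ (linkStratum h N N')]
    [IsManifold (𝓡 n) ∞ N] [IsManifold (𝓡 n') ∞ N']
    (hsub : Manifold.IsSmoothEmbedding (𝓡 m) (prodConeModel n n') ∞
      (Subtype.val : linkStratum h N N' → (N × PosReal) × (N' × PosReal))) :
    IsDiffeoOn (coneModel m) (prodConeModel n n') (stratumMap h N N') univ univ := by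
  have hinv : InvOn (fun q => (linkProj hh q, stratumRadius hh q)) (stratumMap h N N')
      univ univ :=
    ⟨fun p _ => Prod.ext (linkProj_stratumMap hh p) (stratumRadius_stratumMap hh p),
      fun q _ => stratumMap_linkProj hh q⟩
  refine ⟨(contMDiff_stratumMap hsub.contMDiff).contMDiffOn,
    hinv.bijOn (mapsTo_univ _ _) (mapsTo_univ _ _), _, hinv, ContMDiff.contMDiffOn ?_⟩
  suffices hp : ContMDiff (prodConeModel n n') (𝓡 m) ∞
      (linkProj hh : _ → linkStratum h N N') from hp.prodMk (contMDiff_stratumRadius hh)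
  have hsm : ContMDiff (prodConeModel n n') (prodConeModel n n') ∞
      (fun q : (N × PosReal) × (N' × PosReal) => (linkProj hh q).1) := by
    have hs : ContMDiff (prodConeModel n n') 𝓘(ℝ, ℝ) ∞
        (fun q : (N × PosReal) × (N' × PosReal) => (stratumRadius hh q : ℝ)⁻¹) :=
      (PosReal.contMDiff_coe.comp (contMDiff_stratumRadius hh)).inv₀
        fun q => ne_of_gt (stratumRadius hh q).2
    refine ((contMDiff_fst.comp contMDiff_fst).prodMk (PosReal.contMDiff_mk ?_)).prodMk
      ((contMDiff_fst.comp contMDiff_snd).prodMk (PosReal.contMDiff_mk ?_))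
    · exact hs.mul (PosReal.contMDiff_coe.comp (contMDiff_snd.comp contMDiff_fst))
    · exact hs.mul (PosReal.contMDiff_coe.comp (contMDiff_snd.comp contMDiff_snd))
  exact (ContMDiff.iff_comp_isImmersion hsub.isImmersion).2
    ⟨hsub.isEmbedding.continuous_iff.2 hsm.continuous, hsm⟩

/-! ### The metrics under `φ` -/

theorem pullbackForm_sumConeMetric_self
    {F : Type*} [NormedAddCommGroup F] [NormedSpace ℝ F] {G : Type*} [TopologicalSpace G]
    {J : ModelWithCorners ℝ F G} {X : Type*} [TopologicalSpace X] [ChartedSpace G X]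
    {P P' : Type*} [TopologicalSpace P] [ChartedSpace (EuclideanSpace ℝ (Fin n)) P]
    [TopologicalSpace P'] [ChartedSpace (EuclideanSpace ℝ (Fin n')) P']
    (u : ℝ) (g : BilinField (𝓡 n) P) (g' : BilinField (𝓡 n') P')
    {f : X → (P × PosReal) × (P' × PosReal)} {x : X}
    (hf : MDifferentiableAt J (prodConeModel n n') f x) (v : TangentSpace J x) :
    pullbackForm J (prodConeModel n n') f (sumConeMetric u g g') x v v =
      (((f x).1.2 : ℝ) ^ (2 * u) * pullbackForm J (𝓡 n) (fun y => (f y).1.1) g x v v +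
        (show ℝ from mfderiv J 𝓘(ℝ, ℝ) (fun y => ((f y).1.2 : ℝ)) x v) ^ 2) +
      (((f x).2.2 : ℝ) ^ (2 * u) * pullbackForm J (𝓡 n') (fun y => (f y).2.1) g' x v v +
        (show ℝ from mfderiv J 𝓘(ℝ, ℝ) (fun y => ((f y).2.2 : ℝ)) x v) ^ 2) := by
  have h1 : MDifferentiableAt J (coneModel n) (fun y => (f y).1) x :=
    mdifferentiableAt_fst.comp x hf
  have h2 : MDifferentiableAt J (coneModel n') (fun y => (f y).2) x :=
    mdifferentiableAt_snd.comp x hf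
  rw [sumConeMetric, pullbackForm_prodMetric_self _ _ hf, pullbackForm_coneMetric_self _ _ h1,
    pullbackForm_coneMetric_self _ _ h2]

/-- The pull-back `φ^*(g + g')`, in terms of the components of a vector tangent to `M''`. -/
theorem pullbackForm_stratumMap_self
    (hι : ContMDiff (𝓡 m) (prodConeModel n n') ∞
      (Subtype.val : linkStratum h N N' → (N × PosReal) × (N' × PosReal)))
    (u : ℝ) (g : BilinField (𝓡 n) N) (g' : BilinField (𝓡 n') N')
    (p : linkStratum h N N' × PosReal) (v : TangentSpace (coneModel m) p) :
    let w : TangentSpace (𝓡 m) p.1 := mfderiv (coneModel m) (𝓡 m) Prod.fst p v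
    let σ : ℝ := mfderiv (coneModel m) 𝓘(ℝ, ℝ)
      (fun q : linkStratum h N N' × PosReal => (q.2 : ℝ)) p v
    let α : ℝ := mfderiv (𝓡 m) 𝓘(ℝ, ℝ) (fun q : linkStratum h N N' => (q.1.1.2 : ℝ)) p.1 w
    let α' : ℝ := mfderiv (𝓡 m) 𝓘(ℝ, ℝ) (fun q : linkStratum h N N' => (q.1.2.2 : ℝ)) p.1 w
    pullbackForm (coneModel m) (prodConeModel n n') (stratumMap h N N')
        (sumConeMetric u g g') p v v =
      ((p.1.1.1.2 * p.2 : ℝ) ^ (2 * u) *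
          pullbackForm (𝓡 m) (𝓡 n) (fun q : linkStratum h N N' => q.1.1.1) g p.1 w w +
        (p.1.1.1.2 * σ + p.2 * α) ^ 2) +
      ((p.1.1.2.2 * p.2 : ℝ) ^ (2 * u) *
          pullbackForm (𝓡 m) (𝓡 n') (fun q : linkStratum h N N' => q.1.2.1) g' p.1 w w +
        (p.1.1.2.2 * σ + p.2 * α') ^ 2) := by
  intro w σ α α'
  have hd : MDifferentiableAt (𝓡 m) (prodConeModel n n')
      (Subtype.val : linkStratum h N N' → (N × PosReal) × (N' × PosReal)) p.1 :=
    hι.mdifferentiable (by simp) _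
  have ha : MDifferentiableAt (𝓡 m) (𝓡 n) (fun q : linkStratum h N N' => q.1.1.1) p.1 :=
    (contMDiff_fst.comp (contMDiff_fst.comp hι)).mdifferentiable (by simp) _
  have ha' : MDifferentiableAt (𝓡 m) (𝓡 n') (fun q : linkStratum h N N' => q.1.2.1) p.1 :=
    (contMDiff_fst.comp (contMDiff_snd.comp hι)).mdifferentiable (by simp) _
  have hr : MDifferentiableAt (𝓡 m) 𝓘(ℝ, ℝ) (fun q : linkStratum h N N' => (q.1.1.2 : ℝ)) p.1 :=
    (PosReal.contMDiff_coe.comp (contMDiff_snd.comp (contMDiff_fst.comp hι))).mdifferentiable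
      (by simp) _
  have hr' : MDifferentiableAt (𝓡 m) 𝓘(ℝ, ℝ) (fun q : linkStratum h N N' => (q.1.2.2 : ℝ)) p.1 :=
    (PosReal.contMDiff_coe.comp (contMDiff_snd.comp (contMDiff_snd.comp hι))).mdifferentiable
      (by simp) _
  have hfst := mdifferentiableAt_fst (I := 𝓡 m) (I' := 𝓘(ℝ, ℝ)) (x := p)
  rw [pullbackForm_sumConeMetric_self u g g'
    ((contMDiff_stratumMap hι).mdifferentiable (by simp) p)]
  have e1 := pullbackForm_comp_self (g := g) ha hfst v
  have e2 := pullbackForm_comp_self (g := g') ha' hfst v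
  have e3 := mfderiv_mul_radius hr v
  have e4 := mfderiv_mul_radius hr' v
  refine congrArg₂ (· + ·) (congrArg₂ (· + ·) (congrArg _ e1) (congrArg (· ^ 2) e3))
    (congrArg₂ (· + ·) (congrArg _ e2) (congrArg (· ^ 2) e4))

/-- The radial component of a vector tangent to `M''` is the image of its `φ`-push-forward under
the differential of `h(ρ, ρ')`, because `h(ρ, ρ') ∘ φ = ρ''`. -/
theorem mfderiv_radius_eq_fderiv (hh : IsProductRadius h)
    (hι : ContMDiff (𝓡 m) (prodConeModel n n') ∞
      (Subtype.val : linkStratum h N N' → (N × PosReal) × (N' × PosReal)))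
    (p : linkStratum h N N' × PosReal) (v : TangentSpace (coneModel m) p) :
    let w : TangentSpace (𝓡 m) p.1 := mfderiv (coneModel m) (𝓡 m) Prod.fst p v
    let σ : ℝ := mfderiv (coneModel m) 𝓘(ℝ, ℝ)
      (fun q : linkStratum h N N' × PosReal => (q.2 : ℝ)) p v
    let α : ℝ := mfderiv (𝓡 m) 𝓘(ℝ, ℝ) (fun q : linkStratum h N N' => (q.1.1.2 : ℝ)) p.1 w
    let α' : ℝ := mfderiv (𝓡 m) 𝓘(ℝ, ℝ) (fun q : linkStratum h N N' => (q.1.2.2 : ℝ)) p.1 w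
    σ = fderiv ℝ (fun p : ℝ × ℝ => h p.1 p.2) (p.1.1.1.2 * p.2, p.1.1.2.2 * p.2)
      (p.1.1.1.2 * σ + p.2 * α, p.1.1.2.2 * σ + p.2 * α') := by
  intro w σ α α'
  have hr : MDifferentiable (𝓡 m) 𝓘(ℝ, ℝ) (fun q : linkStratum h N N' => (q.1.1.2 : ℝ)) :=
    (PosReal.contMDiff_coe.comp (contMDiff_snd.comp (contMDiff_fst.comp hι))).mdifferentiable
      (by simp)
  have hr' : MDifferentiable (𝓡 m) 𝓘(ℝ, ℝ) (fun q : linkStratum h N N' => (q.1.2.2 : ℝ)) :=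
    (PosReal.contMDiff_coe.comp (contMDiff_snd.comp (contMDiff_snd.comp hι))).mdifferentiable
      (by simp)
  have hφ := contMDiff_stratumMap hι
  have hρ : MDifferentiableAt (coneModel m) 𝓘(ℝ, ℝ)
      (fun q : linkStratum h N N' × PosReal => (q.1.1.1.2 * q.2 : ℝ)) p :=
    (PosReal.contMDiff_coe.comp (contMDiff_snd.comp (contMDiff_fst.comp hφ))).mdifferentiable
      (by simp) p
  have hρ' : MDifferentiableAt (coneModel m) 𝓘(ℝ, ℝ)
      (fun q : linkStratum h N N' × PosReal => (q.1.1.2.2 * q.2 : ℝ)) p :=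
    (PosReal.contMDiff_coe.comp (contMDiff_snd.comp (contMDiff_snd.comp hφ))).mdifferentiable
      (by simp) p
  have e3 := mfderiv_mul_radius (hr p.1) v
  have e4 := mfderiv_mul_radius (hr' p.1) v
  have hH := (hh.differentiableAt (p := (p.1.1.1.2 * p.2, p.1.1.2.2 * p.2))
    ⟨(PosReal.mul p.1.1.1.2 p.2).2,
      (PosReal.mul p.1.1.2.2 p.2).2⟩).hasFDerivAt.hasMFDerivAt
  let D : TangentSpace (coneModel m) p →L[ℝ] ℝ := mfderiv (coneModel m) 𝓘(ℝ, ℝ)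
    (fun q : linkStratum h N N' × PosReal => (q.1.1.1.2 * q.2 : ℝ)) p
  let D' : TangentSpace (coneModel m) p →L[ℝ] ℝ := mfderiv (coneModel m) 𝓘(ℝ, ℝ)
    (fun q : linkStratum h N N' × PosReal => (q.1.1.2.2 * q.2 : ℝ)) p
  have hpair : HasMFDerivAt (coneModel m) 𝓘(ℝ, ℝ × ℝ)
      (fun q : linkStratum h N N' × PosReal => ((q.1.1.1.2 * q.2 : ℝ), (q.1.1.2.2 * q.2 : ℝ))) p
      (D.prod D') :=
    ⟨hρ.hasMFDerivAt.1.prodMk hρ'.hasMFDerivAt.1, hρ.hasMFDerivAt.2.prodMk hρ'.hasMFDerivAt.2⟩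
  have hc := (HasMFDerivAt.comp (g := fun p : ℝ × ℝ => h p.1 p.2) p hH hpair).mfderiv
  have hfun : ((fun p : ℝ × ℝ => h p.1 p.2) ∘
      fun q : linkStratum h N N' × PosReal => ((q.1.1.1.2 * q.2 : ℝ), (q.1.1.2.2 * q.2 : ℝ))) =
      fun q : linkStratum h N N' × PosReal => (q.2 : ℝ) :=
    funext fun q => congrArg Subtype.val (stratumRadius_stratumMap hh q)
  rw [hfun] at hc
  have h5 := congrArg (fun D : TangentSpace (coneModel m) p →L[ℝ] ℝ => D v) hc
  refine h5.trans ?_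
  exact congrArg (fun y : ℝ × ℝ => fderiv ℝ (fun p : ℝ × ℝ => h p.1 p.2)
    (p.1.1.1.2 * p.2, p.1.1.2.2 * p.2) y) (Prod.ext e3 e4)

/-! ### Comparison of the metrics -/

/-- For dimension reasons, `N''` has nonzero tangent vectors without components along `N` and
`N'`. -/
theorem exists_ne_zero_mfderiv_eq_zero (hm : n + n' < m)
    (x : linkStratum h N N') :
    ∃ w : TangentSpace (𝓡 m) x, w ≠ 0 ∧
      mfderiv (𝓡 m) (𝓡 n) (fun q : linkStratum h N N' => q.1.1.1) x w = 0 ∧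
      mfderiv (𝓡 m) (𝓡 n') (fun q : linkStratum h N N' => q.1.2.1) x w = 0 := by
  let D : EuclideanSpace ℝ (Fin m) →ₗ[ℝ] EuclideanSpace ℝ (Fin n) × EuclideanSpace ℝ (Fin n') :=
    (mfderiv (𝓡 m) (𝓡 n) (fun q : linkStratum h N N' => q.1.1.1) x).toLinearMap.prod
      (mfderiv (𝓡 m) (𝓡 n') (fun q : linkStratum h N N' => q.1.2.1) x).toLinearMap
  have hker : LinearMap.ker D ≠ ⊥ := LinearMap.ker_ne_bot_of_finrank_lt (by simpa using hm)
  obtain ⟨w, hw, hw0⟩ := (Submodule.ne_bot_iff _).1 hker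
  exact ⟨w, hw0, congrArg Prod.fst (LinearMap.mem_ker.1 hw),
    congrArg Prod.snd (LinearMap.mem_ker.1 hw)⟩

theorem quasiIsometricOn_stratumMap_one (hh : IsProductRadius h)
    [IsManifold (𝓡 n) ∞ N] [IsManifold (𝓡 n') ∞ N']
    (hι : ContMDiff (𝓡 m) (prodConeModel n n') ∞
      (Subtype.val : linkStratum h N N' → (N × PosReal) × (N' × PosReal)))
    (g₀ : RiemMetric (𝓡 n) N) (g₀' : RiemMetric (𝓡 n') N')
    {g'' : BilinField (𝓡 m) (linkStratum h N N')}
    (hg'' : QuasiIsometricOn (𝓡 m) univ g''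
      (pullbackForm (𝓡 m) (prodConeModel n n') Subtype.val
        (sumConeMetric 1 g₀.form g₀'.form))) :
    QuasiIsometricOn (coneModel m) univ (coneMetric (𝓡 m) 1 g'')
      (pullbackForm (coneModel m) (prodConeModel n n') (stratumMap h N N')
        (sumConeMetric 1 g₀.form g₀'.form)) := by
  obtain ⟨K₀, hK₀, hK⟩ := hg''
  obtain ⟨R, hR, hRle⟩ := hh.exists_max_le_mul
  obtain ⟨B, hB, hBle⟩ := hh.exists_norm_fderiv_le
  have hpos : 0 < 2 * K₀ + 4 * R ^ 2 + (K₀ * (2 + 8 * R ^ 2 * B ^ 2) + 2 * B ^ 2) := by positivity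
  refine ⟨_, hpos, fun p _ v => ?_⟩
  have hσ := mfderiv_radius_eq_fderiv hh hι p v
  have hF := pullbackForm_stratumMap_self hι 1 g₀.form g₀'.form p v
  have hC := coneMetric_self 1 g'' p v
  dsimp only at hσ hF
  set w : TangentSpace (𝓡 m) p.1 := mfderiv (coneModel m) (𝓡 m) Prod.fst p v with hw
  set σ : ℝ := mfderiv (coneModel m) 𝓘(ℝ, ℝ)
      (fun q : linkStratum h N N' × PosReal => (q.2 : ℝ)) p v
  set α : ℝ := mfderiv (𝓡 m) 𝓘(ℝ, ℝ) (fun q : linkStratum h N N' => (q.1.1.2 : ℝ)) p.1 w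
  set α' : ℝ := mfderiv (𝓡 m) 𝓘(ℝ, ℝ) (fun q : linkStratum h N N' => (q.1.2.2 : ℝ)) p.1 w
  obtain ⟨hK1, hK2⟩ := hK p.1 (mem_univ _) w
  rw [pullbackForm_sumConeMetric_self 1 g₀.form g₀'.form
    (hι.mdifferentiable (by simp) p.1)] at hK1 hK2
  have hlink : h p.1.1.1.2 p.1.1.2.2 = 1 := p.1.2
  have hr : 0 < (p.1.1.1.2 : ℝ) := p.1.1.1.2.2
  have hr' : 0 < (p.1.1.2.2 : ℝ) := p.1.1.2.2.2
  have hs : 0 < (p.2 : ℝ) := p.2.2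
  have hmax := hRle _ _ hr.le hr'.le
  rw [hlink, mul_one] at hmax
  have hσle : |σ| ≤ B * (|p.1.1.1.2 * σ + p.2 * α| + |p.1.1.2.2 * σ + p.2 * α'|) := by
    have hle := (fderiv ℝ (fun p : ℝ × ℝ => h p.1 p.2)
      ((p.1.1.1.2 * p.2 : ℝ), (p.1.1.2.2 * p.2 : ℝ))).le_of_opNorm_le
        (hBle _ ⟨mul_pos hr hs, mul_pos hr' hs⟩)
        ((p.1.1.1.2 * σ + p.2 * α : ℝ), (p.1.1.2.2 * σ + p.2 * α' : ℝ))
    rw [← hσ, Real.norm_eq_abs] at hle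
    refine hle.trans (mul_le_mul_of_nonneg_left ?_ hB.le)
    exact max_le (le_add_of_nonneg_right (abs_nonneg _)) (le_add_of_nonneg_left (abs_nonneg _))
  -- real powers to powers with natural exponent
  have h21 : (2 * 1 : ℝ) = (2 : ℕ) := by norm_num
  simp only [h21, Real.rpow_natCast] at hK1 hK2 hF hC
  rw [hF, hC]
  exact cone_comparison hK₀ hr hr' ((le_max_left _ _).trans hmax)
    ((le_max_right _ _).trans hmax) (g₀.form_self_nonneg _ _) (g₀'.form_self_nonneg _ _) hσle
    hK1 hK2

theorem not_quasiIsometricOn_stratumMap (hh : IsProductRadius h)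
    [IsManifold (𝓡 m) ∞ (linkStratum h N N')] (hm : n + n' < m)
    (hN : N.Nonempty) (hN' : N'.Nonempty)
    (hι : ContMDiff (𝓡 m) (prodConeModel n n') ∞
      (Subtype.val : linkStratum h N N' → (N × PosReal) × (N' × PosReal)))
    {u : ℝ} (hu : u < 1) (g : BilinField (𝓡 n) N) (g' : BilinField (𝓡 n') N')
    (g₀'' : RiemMetric (𝓡 m) (linkStratum h N N'))
    {O : Set (Cone (ProductLink h L L'))} (hO : O ∈ 𝓝 Cone.vertex) :
    ¬ QuasiIsometricOn (coneModel m) (linkConeStratumIncl h N N' ⁻¹' O)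
      (coneMetric (𝓡 m) u g₀''.form)
      (pullbackForm (coneModel m) (prodConeModel n n') (stratumMap h N N')
        (sumConeMetric u g g')) := by
  rintro ⟨K, hK, hq⟩
  obtain ⟨a, ha⟩ := hN
  obtain ⟨a', ha'⟩ := hN'
  let x : linkStratum h N N' := linkProj hh
    ((⟨a, ha⟩, ⟨1, mem_Ioi.2 one_pos⟩), (⟨a', ha'⟩, ⟨1, mem_Ioi.2 one_pos⟩))
  obtain ⟨w, hw0, hw, hw'⟩ := exists_ne_zero_mfderiv_eq_zero (n := n) (n' := n') hm x
  have hG : 0 < g₀''.form x w w := g₀''.pos x w hw0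
  let α : ℝ := mfderiv (𝓡 m) 𝓘(ℝ, ℝ) (fun q : linkStratum h N N' => (q.1.1.2 : ℝ)) x w
  let α' : ℝ := mfderiv (𝓡 m) 𝓘(ℝ, ℝ) (fun q : linkStratum h N N' => (q.1.2.2 : ℝ)) x w
  refine not_rpow_le_sq_eventually (A := α ^ 2 + α' ^ 2) hu hK hG ?_
  filter_upwards [Cone.eventually_mk_mem (linkStratumIncl h N N' x) hO, self_mem_nhdsWithin]
    with s hsO hs
  have hs0 : 0 < s := hs
  let p : linkStratum h N N' × PosReal := (x, ⟨s, hs⟩)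
  have hp : p ∈ linkConeStratumIncl h N N' ⁻¹' O := by
    have e : PosReal.toNNReal ⟨s, hs⟩ = s.toNNReal := (Real.toNNReal_of_nonneg hs0.le).symm
    change Cone.mk _ (PosReal.toNNReal ⟨s, hs⟩) ∈ O
    rwa [e]
  let v : TangentSpace (coneModel m) p := (w, (0 : ℝ))
  have hfst : mfderiv (coneModel m) (𝓡 m) Prod.fst p v = w := by
    rw [mfderiv_fst]
    rfl
  have hsnd : mfderiv (coneModel m) 𝓘(ℝ, ℝ)
      (fun q : linkStratum h N N' × PosReal => (q.2 : ℝ)) p v = 0 := by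
    have h1 := mfderiv_comp_apply p (PosReal.contMDiff_coe.mdifferentiable (by simp) p.2)
      (mdifferentiableAt_snd (I := 𝓡 m) (I' := 𝓘(ℝ, ℝ)) (x := p)) v
    refine h1.trans ?_
    rw [mfderiv_snd]
    exact map_zero _
  have hle := (hq p hp v).1
  have hF := pullbackForm_stratumMap_self hι u g g' p v
  have hC := coneMetric_self u g₀''.form p v
  dsimp only at hF
  have hA : pullbackForm (𝓡 m) (𝓡 n) (fun q : linkStratum h N N' => q.1.1.1) g x w w = 0 := by
    change g _ (mfderiv (𝓡 m) (𝓡 n) (fun q : linkStratum h N N' => q.1.1.1) x w) _ = 0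
    rw [hw, map_zero]
    rfl
  have hA' : pullbackForm (𝓡 m) (𝓡 n') (fun q : linkStratum h N N' => q.1.2.1) g' x w w = 0 := by
    change g' _ (mfderiv (𝓡 m) (𝓡 n') (fun q : linkStratum h N N' => q.1.2.1) x w) _ = 0
    rw [hw', map_zero]
    rfl
  have hC' : pullbackForm (coneModel m) (𝓡 m) Prod.fst g₀''.form p v v = g₀''.form x w w :=
    congrArg₂ (fun y z => g₀''.form x y z) hfst hfst
  rw [hfst, hsnd, hA, hA'] at hF
  rw [hC', hsnd] at hC
  rw [hF, hC] at hle
  change K⁻¹ * (s ^ (2 * u) * g₀''.form x w w + (0 : ℝ) ^ 2) ≤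
    (_ * 0 + (_ * 0 + s * α) ^ 2) + (_ * 0 + (_ * 0 + s * α') ^ 2) at hle
  rwa [mul_zero, mul_zero, mul_zero, mul_zero, zero_add, zero_add, zero_add, zero_add, mul_pow,
    mul_pow, ← mul_add, zero_pow two_ne_zero, add_zero] at hle

end Stratum

theorem proposition2p1
    -- nonempty subspaces `N`, `N'` of compact Hausdorff spaces, with smooth manifold structures
    {L L' : Type*} [TopologicalSpace L] [CompactSpace L] [T2Space L]
    [TopologicalSpace L'] [CompactSpace L'] [T2Space L']
    (N : Set L) (N' : Set L') (hN : N.Nonempty) (hN' : N'.Nonempty) (n n' : ℕ)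
    [ChartedSpace (EuclideanSpace ℝ (Fin n)) N] [IsManifold (𝓡 n) ∞ N]
    [ChartedSpace (EuclideanSpace ℝ (Fin n')) N'] [IsManifold (𝓡 n') ∞ N']
    (h : ℝ → ℝ → ℝ) (hh : IsProductRadius h)
    -- the structure of embedded submanifold of `M × M'` on `N''`
    [ChartedSpace (EuclideanSpace ℝ (Fin (n + n' + 1))) (linkStratum h N N')]
    [IsManifold (𝓡 (n + n' + 1)) ∞ (linkStratum h N N')]
    (hsub : Manifold.IsSmoothEmbedding (𝓡 (n + n' + 1)) (prodConeModel n n') ∞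
      (Subtype.val : linkStratum h N N' → (N × PosReal) × (N' × PosReal)))
    -- the exponent, and the metrics on `N`, `N'` and `N''`
    (u : ℝ) (hu : 0 < u)
    (g₀ : RiemMetric (𝓡 n) N) (g₀' : RiemMetric (𝓡 n') N')
    (g₀'' : RiemMetric (𝓡 (n + n' + 1)) (linkStratum h N N'))
    -- the inclusion of `N''` in `M × M'` is quasi-isometric
    (hg₀'' : QuasiIsometricOn (𝓡 (n + n' + 1)) univ g₀''.form
      (pullbackForm (𝓡 (n + n' + 1)) (prodConeModel n n') Subtype.val
        (sumConeMetric u g₀.form g₀'.form))) :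
    -- `φ` is a diffeomorphism of `M''` onto `M × M'`
    IsDiffeoOn (coneModel (n + n' + 1)) (prodConeModel n n') (stratumMap h N N') univ univ ∧
    -- it is a quasi-isometry if `u = 1`
    (u = 1 → IsQuasiIsometryOn (coneModel (n + n' + 1)) (prodConeModel n n')
      (stratumMap h N N') univ univ
      (coneMetric (𝓡 (n + n' + 1)) u g₀''.form) (sumConeMetric u g₀.form g₀'.form)) ∧
    -- if `u < 1`, then `φ : M'' ∩ O → (M × M') ∩ φ(O)` is not, for any neighborhood `O` of `*''`
    (u < 1 → ∀ O ∈ 𝓝 (Cone.vertex : Cone (ProductLink h L L')),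
      ¬ IsQuasiIsometryOn (coneModel (n + n' + 1)) (prodConeModel n n') (stratumMap h N N')
        (linkConeStratumIncl h N N' ⁻¹' O)
        (productStratumIncl N N' ⁻¹' (productConeMap h L L' '' O))
        (coneMetric (𝓡 (n + n' + 1)) u g₀''.form) (sumConeMetric u g₀.form g₀'.form)) := by
  refine ⟨isDiffeoOn_stratumMap hh hsub, ?_, fun hu1 O hO hq =>
    not_quasiIsometricOn_stratumMap hh (Nat.lt_succ_self _) hN hN' hsub.contMDiff hu1 _ _ g₀'' hO
      hq.2⟩
  rintro rfl
  exact ⟨isDiffeoOn_stratumMap hh hsub,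
    quasiIsometricOn_stratumMap_one hh hsub.contMDiff g₀ g₀' hg₀''⟩
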